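/- Let $k,n\ge 3$. For a $k$-ary $n$-tuple $\mathbf a=(a_0,\dots,a_{n-1})\in\mathbb Z_k^n$ write $-\mathbf a^R=(-a_{n-1},\dots,-a_0)$; $\mathbf a$ is negasymmetric if $\mathbf a=-\mathbf a^R$. A negative orientable sequence $\mathcal{NOS}_k(n)$ of period $p$ is a sequence $(s_i)$ over $\mathbb Z_k$ of period $p\geq 1$ whose windows $\mathbf s_n(i)=(s_i,\dots,s_{i+n-1})$ satisfy: $\mathbf s_n(i)=\mathbf s_n(j)$ only if $i\equiv j\pmod p$, and $\mathbf s_n(i)\ne-\mathbf s_n(j)^R$ for all $i,j$. Let $\ell(n,k)$ be the maximum period of an $\mathcal{NOS}_k(n)$. Let $B_k(n-1)$ be the de Bruijn digraph, whose vertices are the $k$-ary $(n-1)$-tuples and whose edges are the $k$-ary $n$-tuples, the edge $(a_0,\dots,a_{n-1})$ going from $(a_0,\dots,a_{n-2})$ to $(a_1,\dots,a_{n-1})$. The pseudoweight of a tuple is the integer sum of its entries (taken in $\{0,\dots,k-1\}$), where each entry $0$ is counted as $k/2$. Let $E_k(n-1)$ and $H_k(n-1)$ be the sets of edges of pseudoweight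 less than, respectively equal to, $kn/2$. Let $\mathcal C_k(n-1)$ be the set of circuits $[\mathbf a]$, $\mathbf a\in H_k(n-1)$, where $[\mathbf a]$ consists of all cyclic shifts of $\mathbf a$. A circuit is negasymmetric if it contains edges $\mathbf a,\mathbf b$ (possibly equal) with $\mathbf a=-\mathbf b^R$. The non-negasymmetric circuits in $\mathcal C_k(n-1)$ fall into reverse-complementary pairs $\{C,-C^R\}$. Let $X_k(n-1)$ be the union of $E_k(n-1)$ and the edge sets of one circuit, chosen arbitrarily, from each such pair. Let $N_i(n,k)$ be the set of negasymmetric circuits in $\mathcal C_k(n-1)$ containing exactly $i$ negasymmetric $n$-tuples, let $n=2^tm$ with $t\ge0$ and $m$ odd, let $\delta=1$ if $k$ is odd and $\delta=2$ if $k$ is even, and put \[ s_k(n-1)=\frac{k^n-n\bigl(|N_0(n,k)|+|N_2(n,k)|\bigr)-m\bigl(|N_1(n,k)|-\delta\bigr)-\delta}{2}. \] Theorem. Let $n\ge3$ and $k\ge3$. For every choice of $X_k(n-1)$, the subgraph of $B_k(n-1)$ with edge set $X_k(n-1)$ has an Eulerian circuit, and the sequence of first entries of the successive edges of any such circuit is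 an $\mathcal{NOS}_k(n)$ whose period, the number $|X_k(n-1)|$ of edges of the circuit, is at least $s_k(n-1)$. Moreover these periods are asymptotically optimal: for each fixed $k\ge3$, \[ \frac{s_k(n-1)}{\ell(n,k)}\to1\quad\text{as } n\to\infty, \] and for each fixed $n\ge3$, \[ \frac{s_k(n-1)}{\ell(n,k)}\to1\quad\text{as } k\to\infty. \] -/

import Mathlib

open Filter Topology

namespace NegOrientable

/-- `k`-ary `n`-tuples; these label the edges of the de Bruijn digraph `B_k(n-1)`. -/
abbrev Tup (k n : ℕ) : Type := Fin n → ZMod k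

/-! ### Negative orientable sequences -/

/-- The window `(s_i, s_{i+1}, …, s_{i+n-1})` of a sequence. -/
def window {k : ℕ} (n : ℕ) (s : ℕ → ZMod k) (i : ℕ) : Tup k n := fun j => s (i + j)

/-- The negative of the reverse of a tuple. -/
def negRev {k n : ℕ} (a : Tup k n) : Tup k n := fun i => -a (Fin.rev i)

/-- `s` is a `k`-ary negative orientable sequence of order `n` and period `p`.
The field `inj` forces `p` to be the least period of `s`. -/
structure IsNOS (k n p : ℕ) (s : ℕ → ZMod k) : Prop where
  pos : 0 < p
  periodic : ∀ i, s (i + p) = s i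
  inj : ∀ i j, window n s i = window n s j → i ≡ j [MOD p]
  neg_orientable : ∀ i j, window n s i ≠ negRev (window n s j)

/-- The set of periods of `k`-ary negative orientable sequences of order `n`. -/
def nosPeriods (n k : ℕ) : Set ℕ := {p | ∃ s : ℕ → ZMod k, IsNOS k n p s}

/-- `ℓ(n,k)`: the maximum period of a `k`-ary negative orientable sequence of order `n`. -/
noncomputable def maxPeriod (n k : ℕ) : ℕ := sSup (nosPeriods n k)

/-! ### The de Bruijn digraph `B_k(n-1)` -/

/-- The initial vertex `(a_0, …, a_{n-2})` of the edge `(a_0, …, a_{n-1})`. -/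
def source {k n : ℕ} (a : Tup k n) : Tup k (n - 1) := fun i => a ⟨i, by omega⟩

/-- The terminal vertex `(a_1, …, a_{n-1})` of the edge `(a_0, …, a_{n-1})`. -/
def target {k n : ℕ} (a : Tup k n) : Tup k (n - 1) := fun i => a ⟨i + 1, by omega⟩

/-- `c` is an Eulerian circuit, with `M` edges, of the subgraph with edge set `X`: a closed
directed walk (written as an `M`-periodic sequence of edges) which passes through every edge
of `X`, and no other edge, exactly once per period. -/
structure IsEulerianCircuit {k n : ℕ} (X : Set (Tup k n)) (M : ℕ) (c : ℕ → Tup k n) : Prop where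
  pos : 0 < M
  closed : ∀ i, c (i + M) = c i
  walk : ∀ i, target (c i) = source (c (i + 1))
  bij : Set.BijOn c (Set.Iio M) X

/-- The pseudoweight: the integer sum of the entries, with every `0` counted as `k/2`. -/
def pseudoweight {k n : ℕ} (a : Tup k n) : ℚ :=
  ∑ i, if a i = 0 then (k : ℚ) / 2 else ((a i).val : ℚ)

/-- `E_k(n-1)`: the edges of pseudoweight less than `kn/2`. -/
def lowEdges (k n : ℕ) : Set (Tup k n) := {a | pseudoweight a < (k : ℚ) * n / 2}

/-- `H_k(n-1)`: the edges of pseudoweight exactly `kn/2`. -/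
def midEdges (k n : ℕ) : Set (Tup k n) := {a | pseudoweight a = (k : ℚ) * n / 2}

/-! ### Circuits of cyclic shifts -/

/-- The cyclic shift of a tuple by `j` places. -/
def rot {k n : ℕ} (a : Tup k n) (j : ℕ) : Tup k n :=
  fun i => a ⟨(i + j) % n, Nat.mod_lt _ i.pos⟩

/-- The edge set of the circuit `[a_0, …, a_{n-1}]`: all cyclic shifts of `a`. -/
def circuit {k n : ℕ} (a : Tup k n) : Set (Tup k n) := Set.range (rot a)

/-- `𝒞_k(n-1)`: the circuits `[a]` with `a` an edge of `H_k(n-1)`. -/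
def circuits (k n : ℕ) : Set (Set (Tup k n)) := circuit '' midEdges k n

/-- A negasymmetric tuple equals the negative of its reverse. -/
def IsNegasymmetric {k n : ℕ} (a : Tup k n) : Prop := a = negRev a

/-- A circuit is negasymmetric if `a = -b^R` for some, not necessarily distinct, edges `a, b`
of it. -/
def IsNegasymmetricCircuit {k n : ℕ} (C : Set (Tup k n)) : Prop :=
  ∃ a ∈ C, ∃ b ∈ C, a = negRev b

/-- `X` is a set `X_k(n-1)`: the union of `E_k(n-1)` and of the edge sets of a family `D` of
non-negasymmetric circuits of `𝒞_k(n-1)` that contains exactly one circuit of each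
reverse-complementary pair `{C, -C^R}`. -/
def IsX (k n : ℕ) (X : Set (Tup k n)) : Prop :=
  ∃ D : Set (Set (Tup k n)),
    (∀ C ∈ D, C ∈ circuits k n ∧ ¬ IsNegasymmetricCircuit C) ∧
    (∀ C ∈ circuits k n, ¬ IsNegasymmetricCircuit C → (C ∈ D ↔ negRev '' C ∉ D)) ∧
    X = lowEdges k n ∪ ⋃₀ D

/-! ### The bound `s_k(n-1)` -/

/-- `N_i(n,k)`: the negasymmetric circuits of `𝒞_k(n-1)` with exactly `i` negasymmetric
`n`-tuples. -/
def negCircuits (i n k : ℕ) : Set (Set (Tup k n)) :=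
  {C | C ∈ circuits k n ∧ IsNegasymmetricCircuit C ∧ {a ∈ C | IsNegasymmetric a}.ncard = i}

/-- `δ = 1` for odd `k` and `δ = 2` for even `k`. -/
def delta (k : ℕ) : ℕ := if Even k then 2 else 1

/-- The odd part `m` of `n = 2^t m`. -/
def oddPart (n : ℕ) : ℕ := n / 2 ^ padicValNat 2 n

/-- The number `s_k(n-1)`; the second argument is the tuple length `n`. -/
noncomputable def sBound (k n : ℕ) : ℝ :=
  ((k : ℝ) ^ n - n * (((negCircuits 0 n k).ncard : ℝ) + (negCircuits 2 n k).ncard)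
    - oddPart n * (((negCircuits 1 n k).ncard : ℝ) - delta k) - delta k) / 2

end NegOrientable

namespace NegOrientable

variable {k n : ℕ}

/-! ### Cyclic shifts and reverse complements -/

/-! Cyclic shifts preserve pseudoweight, and the reverse complement sends weight `w` to `kn - w`.
Hence the edges off the middle level split into `E` and its reverse complement, while the middle
level splits into circuits. Taking one circuit from each pair makes `X` disjoint from its reverse
complement, and only negasymmetric circuits are missed by both.

Shifting by one place permutes `X` and is a successor map on edges, so `X` is covered by closed
walks. They can be merged into one because every edge leads to the constant tuple `1`: the entry `1`
is the strictly lightest, so appending it repeatedly stays inside `X` (`IsX.appendOne_mem`,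
`exists_successor_perm_sameCycle`). The windows of the resulting sequence are the edges of `X`.

Therefore `k^n` is at most `2|X|` plus the total length of the negasymmetric circuits. Those with
exactly one negasymmetric tuple have odd length dividing `n`, hence at most `m`, and `δ` of them are
constant, of length one; this gives `sBound`.

Any such sequence has period at most `k^n / 2`, since its windows and their reverse complements are
disjoint. A tuple on a negasymmetric circuit is determined by about half of its entries, so the loss
is of relative order `n^2 / k^((n-1)/2)`. -/

lemma rot_rot (a : Tup k n) (i j : ℕ) : rot (rot a i) j = rot a (i + j) := by
  funext x
  simp only [rot]
  congr 2
  rw [Nat.mod_add_mod, add_assoc, add_comm j i]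

lemma rot_mul_self (a : Tup k n) (j : ℕ) : rot a (n * j) = a := by
  funext x
  simp only [rot]
  congr 1
  ext
  simp [Nat.mod_eq_of_lt x.isLt]

lemma rot_zero (a : Tup k n) : rot a 0 = a := by
  simpa using rot_mul_self a 0

lemma rot_eq_iterate (a : Tup k n) (j : ℕ) : rot a j = (fun b => rot b 1)^[j] a := by
  induction j with
  | zero => simp [rot_zero]
  | succ j ih => rw [Function.iterate_succ_apply', ← ih, rot_rot]

lemma rot_rot_sub (a : Tup k n) (j : ℕ) : rot (rot a j) (n * j - j) = a := by
  rcases Nat.eq_zero_or_pos n with rfl | hn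
  · exact Subsingleton.elim _ _
  · rw [rot_rot, Nat.add_sub_cancel' (Nat.le_mul_of_pos_left j hn), rot_mul_self]

lemma rot_injective (j : ℕ) : Function.Injective (fun a : Tup k n => rot a j) := by
  intro a b h
  simp only at h
  rw [← rot_rot_sub a j, h, rot_rot_sub]

lemma negRev_negRev (a : Tup k n) : negRev (negRev a) = a := by
  funext x
  simp [negRev]

lemma negRev_injective : Function.Injective (negRev : Tup k n → Tup k n) :=
  Function.LeftInverse.injective negRev_negRev

/-- Reversal turns a forward shift into a backward one, so shifting forward again cancels it. -/
lemma rot_negRev_rot (a : Tup k n) (j : ℕ) : rot (negRev (rot a j)) j = negRev a := by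
  funext x
  simp only [rot, negRev]
  congr 2
  ext
  simp only [Fin.val_rev]
  have h1 := Nat.div_add_mod (x + j) n
  have h2 := Nat.mod_lt (x + j) x.pos
  have h3 : n - ((x + j) % n + 1) + j = n - (x + 1) + n * ((x + j) / n) := by
    have := x.isLt
    omega
  rw [h3, Nat.add_mul_mod_self_left, Nat.mod_eq_of_lt (by have := x.isLt; omega)]

lemma mem_circuit_self (a : Tup k n) : a ∈ circuit a := ⟨0, rot_zero a⟩

lemma rot_mem_circuit (a : Tup k n) (j : ℕ) : rot a j ∈ circuit a := ⟨j, rfl⟩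

lemma circuit_rot (a : Tup k n) (j : ℕ) : circuit (rot a j) = circuit a := by
  ext b
  constructor
  · rintro ⟨i, rfl⟩
    rw [rot_rot]
    exact rot_mem_circuit _ _
  · rintro ⟨i, rfl⟩
    refine ⟨n * j - j + i, ?_⟩
    rw [← rot_rot, rot_rot_sub]

lemma circuit_eq_of_mem {a b : Tup k n} (h : b ∈ circuit a) : circuit b = circuit a := by
  obtain ⟨j, rfl⟩ := h
  exact circuit_rot a j

lemma circuit_negRev (a : Tup k n) : negRev '' circuit a = circuit (negRev a) := by
  have key : ∀ a : Tup k n, negRev '' circuit a ⊆ circuit (negRev a) := by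
    rintro a _ ⟨_, ⟨j, rfl⟩, rfl⟩
    have := circuit_rot (negRev (rot a j)) j
    rw [rot_negRev_rot] at this
    rw [this]
    exact mem_circuit_self _
  refine (key a).antisymm fun b hb => ?_
  have := key _ (Set.mem_image_of_mem negRev hb)
  rw [negRev_negRev] at this
  exact ⟨_, this, negRev_negRev b⟩

/-- Circuits are orbits, so a circuit and its reverse complement coincide as soon as they meet. -/
lemma isNegasymmetricCircuit_circuit_iff (a : Tup k n) :
    IsNegasymmetricCircuit (circuit a) ↔ circuit (negRev a) = circuit a := by
  constructor
  · rintro ⟨b, hb, c, hc, rfl⟩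
    rw [← circuit_eq_of_mem hb, ← circuit_negRev c, circuit_eq_of_mem hc, circuit_negRev]
  · intro h
    exact ⟨_, h ▸ mem_circuit_self _, a, mem_circuit_self a, rfl⟩

lemma ncard_circuit_le (hn : 0 < n) (a : Tup k n) : (circuit a).ncard ≤ n := by
  have h : circuit a ⊆ rot a '' Set.Iio n := by
    rintro _ ⟨j, rfl⟩
    refine ⟨j % n, Nat.mod_lt _ hn, ?_⟩
    conv_rhs => rw [← Nat.div_add_mod j n, ← rot_rot, rot_mul_self]
  calc (circuit a).ncard ≤ (rot a '' Set.Iio n).ncard :=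
        Set.ncard_le_ncard h ((Set.finite_Iio n).image _)
    _ ≤ (Set.Iio n).ncard := Set.ncard_image_le (Set.finite_Iio n)
    _ = n := by simp

/-! ### The pseudoweight -/

/-- The contribution of one entry to the pseudoweight. -/
def entryWeight {k : ℕ} (x : ZMod k) : ℚ := if x = 0 then (k : ℚ) / 2 else (x.val : ℚ)

lemma pseudoweight_eq_sum (a : Tup k n) : pseudoweight a = ∑ i, entryWeight (a i) := rfl

lemma entryWeight_neg [NeZero k] (x : ZMod k) : entryWeight (-x) = k - entryWeight x := by
  unfold entryWeight
  by_cases hx : x = 0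
  · simp [hx]
    ring
  · rw [if_neg (neg_ne_zero.2 hx), if_neg hx, ZMod.neg_val, if_neg hx,
      Nat.cast_sub (ZMod.val_lt x).le]

lemma entryWeight_one (hk : 3 ≤ k) : entryWeight (1 : ZMod k) = 1 := by
  have : Fact (1 < k) := ⟨by omega⟩
  simp [entryWeight, ZMod.val_one]

/-- Counting `0` as `k/2` makes `1` the unique lightest entry exactly because `k/2 > 1`. -/
lemma one_lt_entryWeight (hk : 3 ≤ k) {x : ZMod k} (hx : x ≠ 1) : 1 < entryWeight x := by
  have : Fact (1 < k) := ⟨by omega⟩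
  have : NeZero k := ⟨by omega⟩
  unfold entryWeight
  split_ifs with h
  · have : (3 : ℚ) ≤ k := by exact_mod_cast hk
    linarith
  · have h0 : x.val ≠ 0 := by rwa [Ne, ZMod.val_eq_zero]
    have h1 : x.val ≠ 1 := fun h1 => hx (ZMod.val_injective k (by rw [h1, ZMod.val_one]))
    exact_mod_cast (by omega : 1 < x.val)

lemma pseudoweight_rot (a : Tup k n) (j : ℕ) : pseudoweight (rot a j) = pseudoweight a := by
  have hinj : Function.Injective
      (fun i : Fin n => (⟨(i + j) % n, Nat.mod_lt _ i.pos⟩ : Fin n)) := by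
    intro x y h
    have h' : (x + j : ℕ) ≡ y + j [MOD n] := by simpa [Nat.ModEq] using h
    have := Nat.ModEq.add_right_cancel' j h'
    ext
    rwa [Nat.ModEq, Nat.mod_eq_of_lt x.isLt, Nat.mod_eq_of_lt y.isLt] at this
  exact (Finite.injective_iff_bijective.1 hinj).sum_comp (fun i => entryWeight (a i))

lemma pseudoweight_negRev [NeZero k] (a : Tup k n) :
    pseudoweight (negRev a) = k * n - pseudoweight a := by
  have h : ∑ i : Fin n, entryWeight (a (Fin.rev i)) = ∑ i, entryWeight (a i) :=
    Equiv.sum_comp Fin.revPerm (fun i => entryWeight (a i))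
  simp only [pseudoweight_eq_sum, negRev, entryWeight_neg, Finset.sum_sub_distrib, h]
  simp [mul_comm]

lemma negRev_mem_midEdges [NeZero k] {a : Tup k n} (h : a ∈ midEdges k n) :
    negRev a ∈ midEdges k n := by
  simp only [midEdges, Set.mem_ofPred_eq] at *
  rw [pseudoweight_negRev, h]
  ring

lemma mem_midEdges_of_mem_circuit {a b : Tup k n} (ha : a ∈ midEdges k n)
    (hb : b ∈ circuit a) : b ∈ midEdges k n := by
  obtain ⟨j, rfl⟩ := hb
  simpa only [midEdges, Set.mem_ofPred_eq, pseudoweight_rot] using ha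

lemma eq_circuit_of_mem {C : Set (Tup k n)} (hC : C ∈ circuits k n) {a : Tup k n} (ha : a ∈ C) :
    C = circuit a ∧ a ∈ midEdges k n := by
  obtain ⟨b, hb, rfl⟩ := hC
  exact ⟨(circuit_eq_of_mem ha).symm, mem_midEdges_of_mem_circuit hb ha⟩

/-! ### The edge sets `X` -/

/-- On non-negasymmetric circuits the reverse complement is an involution without fixed points; a
well-order on edge sets picks the smaller member of each pair. -/
theorem exists_isX [NeZero k] : ∃ X : Set (Tup k n), IsX k n X := by
  classical
  let r : Set (Tup k n) → Set (Tup k n) → Prop := WellOrderingRel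
  let D : Set (Set (Tup k n)) :=
    {C | (C ∈ circuits k n ∧ ¬ IsNegasymmetricCircuit C) ∧ r C (negRev '' C)}
  refine ⟨_, D, fun C hC => hC.1, fun C hC hneg => ?_, rfl⟩
  obtain ⟨a, ha, rfl⟩ := hC
  have hne := mt (isNegasymmetricCircuit_circuit_iff a).2 hneg
  have h2 : ¬ IsNegasymmetricCircuit (circuit (negRev a)) := by
    rw [isNegasymmetricCircuit_circuit_iff, negRev_negRev]
    exact fun h => hne h.symm
  have h3 : circuit (negRev a) ∈ circuits k n := ⟨_, negRev_mem_midEdges ha, rfl⟩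
  have h4 : circuit a ∈ circuits k n := ⟨a, ha, rfl⟩
  simp only [D, Set.mem_ofPred_eq, circuit_negRev, negRev_negRev, h2, h3, h4, hneg, true_and,
    not_false_eq_true]
  constructor
  · exact fun h h' => asymm_of r h h'
  · intro h
    rcases trichotomous_of r (circuit a) (circuit (negRev a)) with h' | h' | h'
    · exact h'
    · exact absurd h'.symm hne
    · exact absurd h' h

namespace IsX

variable {X : Set (Tup k n)}

lemma lowEdges_subset (hX : IsX k n X) : lowEdges k n ⊆ X := by
  obtain ⟨D, -, -, rfl⟩ := hX
  exact Set.subset_union_left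

lemma rot_mem (hX : IsX k n X) {a : Tup k n} (ha : a ∈ X) (j : ℕ) : rot a j ∈ X := by
  obtain ⟨D, hD, -, rfl⟩ := hX
  rcases ha with ha | ⟨C, hC, ha⟩
  · left
    simpa only [lowEdges, Set.mem_ofPred_eq, pseudoweight_rot] using ha
  · refine Or.inr ⟨C, hC, ?_⟩
    rw [(eq_circuit_of_mem (hD C hC).1 ha).1]
    exact rot_mem_circuit a j

lemma pseudoweight_le (hX : IsX k n X) {a : Tup k n} (ha : a ∈ X) :
    pseudoweight a ≤ (k : ℚ) * n / 2 := by
  obtain ⟨D, hD, -, rfl⟩ := hX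
  rcases ha with ha | ⟨C, hC, ha⟩
  · exact le_of_lt ha
  · exact le_of_eq (eq_circuit_of_mem (hD C hC).1 ha).2

/-- The two weights add up to `kn` and neither exceeds `kn/2`, so both tuples are on the middle
level, and `D` would contain both circuits of a pair. -/
lemma negRev_notMem [NeZero k] (hX : IsX k n X) {a : Tup k n} (ha : a ∈ X) : negRev a ∉ X := by
  intro hb
  have h1 := hX.pseudoweight_le ha
  have h2 := hX.pseudoweight_le hb
  have h3 := pseudoweight_negRev a
  obtain ⟨D, hD, hpair, rfl⟩ := hX
  rcases ha with ha | ⟨C, hC, ha⟩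
  · have ha' : pseudoweight a < (k : ℚ) * n / 2 := ha
    linarith
  rcases hb with hb | ⟨C', hC', hb⟩
  · have hb' : pseudoweight (negRev a) < (k : ℚ) * n / 2 := hb
    linarith
  refine (hpair C (hD C hC).1 (hD C hC).2).1 hC ?_
  rw [(eq_circuit_of_mem (hD C hC).1 ha).1, circuit_negRev,
    ← (eq_circuit_of_mem (hD C' hC').1 hb).1]
  exact hC'

/-- A tuple outside `X` and its reverse complement lies on a negasymmetric circuit. -/
lemma mem_or_negRev_mem_or [NeZero k] (hX : IsX k n X) (a : Tup k n) :
    a ∈ X ∨ negRev a ∈ X ∨ (a ∈ midEdges k n ∧ IsNegasymmetricCircuit (circuit a)) := by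
  by_cases hm : a ∈ midEdges k n
  · by_cases hneg : IsNegasymmetricCircuit (circuit a)
    · exact Or.inr (Or.inr ⟨hm, hneg⟩)
    obtain ⟨D, hD, hpair, rfl⟩ := hX
    by_cases h : circuit a ∈ D
    · exact Or.inl (Or.inr ⟨_, h, mem_circuit_self a⟩)
    · have := not_not.1 (mt (hpair _ ⟨a, hm, rfl⟩ hneg).2 h)
      exact Or.inr (Or.inl (Or.inr ⟨_, this, Set.mem_image_of_mem _ (mem_circuit_self a)⟩))
  · rcases lt_or_gt_of_ne (show pseudoweight a ≠ (k : ℚ) * n / 2 from hm) with h | h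
    · exact Or.inl (hX.lowEdges_subset h)
    · refine Or.inr (Or.inl (hX.lowEdges_subset ?_))
      have h3 := pseudoweight_negRev a
      show pseudoweight (negRev a) < (k : ℚ) * n / 2
      linarith

end IsX

/-! ### Eulerian circuits by merging cycles -/

/-- Composing with the transposition of two points of distinct cycles merges these cycles. -/
lemma sameCycle_mul_swap {E : Type*} [Finite E] [DecidableEq E] (σ : Equiv.Perm E) {f g : E}
    (hfg : ¬ σ.SameCycle g f) :
    (σ * Equiv.swap f g).SameCycle f g ∧
      ∀ x y, σ.SameCycle x y → (σ * Equiv.swap f g).SameCycle x y := by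
  set τ := σ * Equiv.swap f g with hτ
  have hτf : τ f = σ g := by simp [hτ]
  have hτg : τ g = σ f := by simp [hτ]
  have hτx : ∀ x, x ≠ f → x ≠ g → τ x = σ x := fun x h1 h2 => by
    simp [hτ, Equiv.swap_apply_of_ne_of_ne h1 h2]
  have hsame : τ.SameCycle f g := by
    by_contra hcon
    -- After the first step from `f` to `σ g`, `τ` follows the `σ`-cycle of `g`. That cycle avoids
    -- `f`, so `τ` agrees with `σ` until `g` is reached.
    have hall : ∀ j : ℕ, τ.SameCycle f ((σ ^ j) (σ g)) := by
      intro j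
      induction j with
      | zero =>
        rw [pow_zero, Equiv.Perm.one_apply, ← hτf]
        exact Equiv.Perm.sameCycle_apply_right.2 (Equiv.Perm.SameCycle.refl τ f)
      | succ j ih =>
        rw [pow_succ', Equiv.Perm.mul_apply, ← hτx]
        · exact Equiv.Perm.sameCycle_apply_right.2 ih
        · intro h
          refine hfg ⟨j + 1, ?_⟩
          rw [← h, zpow_add, zpow_one, Equiv.Perm.mul_apply, zpow_natCast]
        · intro h
          exact hcon (h ▸ ih)
    obtain ⟨j, hj⟩ := (Equiv.Perm.sameCycle_apply_left.2
      (Equiv.Perm.SameCycle.refl σ g)).exists_nat_pow_eq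
    exact hcon (hj ▸ hall j)
  refine ⟨hsame, ?_⟩
  have hstep : ∀ x, τ.SameCycle x (σ x) := by
    intro x
    by_cases h1 : x = f
    · subst h1
      rw [← hτg]
      exact Equiv.Perm.sameCycle_apply_right.2 hsame
    by_cases h2 : x = g
    · subst h2
      rw [← hτf]
      exact Equiv.Perm.sameCycle_apply_right.2 hsame.symm
    rw [← hτx x h1 h2]
    exact Equiv.Perm.sameCycle_apply_right.2 (Equiv.Perm.SameCycle.refl τ x)
  intro x y hxy
  obtain ⟨j, rfl⟩ := hxy.exists_nat_pow_eq
  induction j with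
  | zero => exact Equiv.Perm.SameCycle.refl τ x
  | succ j ih =>
    rw [pow_succ', Equiv.Perm.mul_apply]
    exact (ih ⟨j, by rw [zpow_natCast]⟩).trans (hstep _)

/-- A finite directed multigraph with a successor permutation of its edges, in which every edge
reaches a fixed edge `e₀`, has a successor permutation with a single cycle. -/
theorem exists_successor_perm_sameCycle {E V : Type*} [Finite E] (src tgt : E → V) (e₀ : E)
    (hsucc : ∃ σ : Equiv.Perm E, ∀ e, src (σ e) = tgt e)
    (hreach : ∀ e, Relation.ReflTransGen (fun f g => tgt f = src g) e e₀) :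
    ∃ σ : Equiv.Perm E, (∀ e, src (σ e) = tgt e) ∧ ∀ e, σ.SameCycle e₀ e := by
  classical
  -- Choose the successor permutation whose cycle through `e₀` is longest; if it misses an edge, a
  -- merge lengthens it.
  obtain ⟨σ, hσ, hmax⟩ := Set.exists_max_image {σ : Equiv.Perm E | ∀ e, src (σ e) = tgt e}
    (fun σ => {e | σ.SameCycle e₀ e}.ncard) (Set.toFinite _) hsucc
  refine ⟨σ, hσ, ?_⟩
  by_contra hcon
  -- A path to `e₀` from a missed edge must enter the cycle somewhere.
  have hstep : ∃ f f', tgt f = src f' ∧ ¬ σ.SameCycle e₀ f ∧ σ.SameCycle e₀ f' := by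
    by_contra hno
    push Not at hno
    refine hcon fun e => ?_
    induction hreach e using Relation.ReflTransGen.head_induction_on with
    | refl => exact Equiv.Perm.SameCycle.refl σ e₀
    | head h _ ih =>
      by_contra h'
      exact hno _ _ h h' ih
  obtain ⟨f, f', hff', hf, hf'⟩ := hstep
  -- The predecessor `g` of `f'` on the cycle has the same target as `f`, so exchanging their
  -- successors is legitimate.
  set g := σ⁻¹ f' with hg
  have hgf' : σ g = f' := by simp [hg]
  have hg0 : σ.SameCycle e₀ g := by
    rw [← hgf'] at hf'
    exact Equiv.Perm.sameCycle_apply_right.1 hf'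
  obtain ⟨h1, h2⟩ := sameCycle_mul_swap σ (f := f) (g := g) fun h => hf (hg0.trans h)
  have htg : tgt g = tgt f := by rw [← hσ g, hgf', hff']
  have hτ : ∀ e, src ((σ * Equiv.swap f g) e) = tgt e := by
    intro e
    rw [Equiv.Perm.mul_apply, hσ]
    by_cases he : e = f
    · rw [he, Equiv.swap_apply_left, htg]
    by_cases he' : e = g
    · rw [he', Equiv.swap_apply_right, htg]
    rw [Equiv.swap_apply_of_ne_of_ne he he']
  refine absurd (hmax _ hτ) (not_le.2 (Set.ncard_lt_ncard ?_ (Set.toFinite _)))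
  exact ⟨fun e he => h2 _ _ he, fun h => hf (h ((h2 _ _ hg0).trans h1.symm))⟩

/-- The edge following `a` whose last entry is `1`. -/
def appendOne (a : Tup k n) : Tup k n :=
  fun i => if h : (i : ℕ) + 1 < n then a ⟨i + 1, h⟩ else 1

lemma source_rot_one (a : Tup k n) : source (rot a 1) = target a := by
  funext i
  simp only [source, target, rot]
  congr 2
  exact Nat.mod_eq_of_lt (by omega)

lemma source_appendOne (a : Tup k n) : source (appendOne a) = target a := by
  funext i
  have : (i : ℕ) + 1 < n := by omega
  simp [source, target, appendOne, this]

lemma iterate_appendOne (a : Tup k n) : appendOne^[n] a = fun _ => 1 := by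
  have h : ∀ (j : ℕ) (i : Fin n), n ≤ i + j → (appendOne^[j] a) i = 1 := by
    intro j
    induction j with
    | zero => intro i hi; omega
    | succ j ih =>
      intro i hi
      rw [Function.iterate_succ_apply', appendOne]
      split_ifs with h
      · exact ih _ (by simp only; omega)
      · rfl
  exact funext fun i => h n i (by omega)

/-- Appending `1` is a shift by one place followed by overwriting the last entry with `1`: either
nothing is overwritten, or the weight drops strictly and the edge is low. -/
lemma IsX.appendOne_mem (hn : 0 < n) (hk : 3 ≤ k) {X : Set (Tup k n)} (hX : IsX k n X)
    {a : Tup k n} (ha : a ∈ X) : appendOne a ∈ X := by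
  have hupd : appendOne a = Function.update (rot a 1) ⟨n - 1, by omega⟩ 1 := by
    funext i
    by_cases hi : i = ⟨n - 1, by omega⟩
    · subst hi
      have : ¬ (n - 1 + 1 < n) := by omega
      simp [appendOne, this]
    · have hlt : (i : ℕ) + 1 < n := by
        have : (i : ℕ) ≠ n - 1 := fun h => hi (Fin.ext h)
        omega
      rw [Function.update_of_ne hi]
      simp [appendOne, hlt, rot, Nat.mod_eq_of_lt hlt]
  by_cases h1 : rot a 1 ⟨n - 1, by omega⟩ = 1
  · rw [hupd, ← h1, Function.update_eq_self]
    exact hX.rot_mem ha 1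
  · refine hX.lowEdges_subset ?_
    show pseudoweight (appendOne a) < (k : ℚ) * n / 2
    refine lt_of_lt_of_le ?_ (hX.pseudoweight_le (hX.rot_mem ha 1))
    rw [hupd, pseudoweight_eq_sum, pseudoweight_eq_sum]
    refine Finset.sum_lt_sum (fun i _ => ?_) ⟨⟨n - 1, by omega⟩, Finset.mem_univ _, ?_⟩
    · by_cases hi : i = ⟨n - 1, by omega⟩
      · subst hi
        rw [Function.update_self, entryWeight_one hk]
        exact (one_lt_entryWeight hk h1).le
      · rw [Function.update_of_ne hi]
    · rw [Function.update_self, entryWeight_one hk]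
      exact one_lt_entryWeight hk h1

lemma IsX.one_mem (hn : 0 < n) (hk : 3 ≤ k) {X : Set (Tup k n)} (hX : IsX k n X) :
    (fun _ => 1) ∈ X := by
  refine hX.lowEdges_subset ?_
  show pseudoweight (fun _ => (1 : ZMod k)) < (k : ℚ) * n / 2
  have h1 : (3 : ℚ) ≤ k := by exact_mod_cast hk
  have h2 : (0 : ℚ) < n := by exact_mod_cast hn
  simp only [pseudoweight_eq_sum, entryWeight_one hk, Finset.sum_const, Finset.card_univ,
    Fintype.card_fin, nsmul_eq_mul, mul_one]
  nlinarith

theorem IsX.exists_isEulerianCircuit (hn : 0 < n) (hk : 3 ≤ k) {X : Set (Tup k n)}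
    (hX : IsX k n X) : ∃ (M : ℕ) (c : ℕ → Tup k n), IsEulerianCircuit X M c := by
  classical
  have : NeZero k := ⟨by omega⟩
  have : Fintype X := Fintype.ofFinite X
  let e₀ : X := ⟨fun _ => 1, hX.one_mem hn hk⟩
  have hinj : Function.Injective (fun a : X => (⟨rot a 1, hX.rot_mem a.2 1⟩ : X)) := by
    intro a b h
    exact Subtype.ext (rot_injective 1 (congrArg Subtype.val h))
  obtain ⟨σ, hσ, hcyc⟩ := exists_successor_perm_sameCycle (E := X)
    (fun a => source (a : Tup k n)) (fun a => target (a : Tup k n)) e₀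
    ⟨Equiv.ofBijective _ (Finite.injective_iff_bijective.1 hinj),
      fun a => source_rot_one (a : Tup k n)⟩
    (by
      have hiter : ∀ (j : ℕ) (a : X), ∃ h : appendOne^[j] (a : Tup k n) ∈ X,
          Relation.ReflTransGen (fun f g : X => target (f : Tup k n) = source (g : Tup k n))
            a ⟨_, h⟩ := by
        intro j
        induction j with
        | zero => exact fun a => ⟨a.2, Relation.ReflTransGen.refl⟩
        | succ j ih =>
          intro a
          obtain ⟨h, hr⟩ := ih a
          have h' : appendOne^[j + 1] (a : Tup k n) ∈ X := by
            rw [Function.iterate_succ_apply']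
            exact hX.appendOne_mem hn hk h
          refine ⟨h', hr.tail ?_⟩
          simp only [Function.iterate_succ_apply', source_appendOne]
      intro a
      obtain ⟨h, hr⟩ := hiter n a
      have : (⟨_, h⟩ : X) = e₀ := Subtype.ext (iterate_appendOne _)
      rwa [this] at hr)
  have hon : σ.IsCycleOn ((Finset.univ : Finset X) : Set X) := by
    refine ⟨by simp [Set.bijOn_univ], fun x _ y _ => ?_⟩
    exact (hcyc x).symm.trans (hcyc y)
  have hmem : ∀ x : X, x ∈ (Finset.univ : Finset X) := Finset.mem_univ
  refine ⟨Fintype.card X, fun i => ((σ ^ i) e₀ : X), ?_, ?_, ?_, ?_, ?_, ?_⟩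
  · exact Fintype.card_pos_iff.2 ⟨e₀⟩
  · intro i
    have := hon.pow_card_apply (hmem e₀)
    rw [Finset.card_univ] at this
    simp only [pow_add, Equiv.Perm.mul_apply, this]
  · intro i
    simp only [pow_succ', Equiv.Perm.mul_apply]
    exact (hσ _).symm
  · exact fun i _ => ((σ ^ i) e₀).2
  · intro i hi j hj hij
    have := (hon.pow_apply_eq_pow_apply (hmem e₀)).1 (Subtype.ext hij)
    rw [Finset.card_univ, Nat.ModEq, Nat.mod_eq_of_lt hi, Nat.mod_eq_of_lt hj] at this
    exact this
  · intro a ha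
    obtain ⟨j, hj, hja⟩ := hon.exists_pow_eq (hmem e₀) (hmem ⟨a, ha⟩)
    rw [Finset.card_univ] at hj
    exact ⟨j, hj, by simp only [hja]⟩

/-! ### Sequences read off Eulerian circuits -/

namespace IsEulerianCircuit

variable {X : Set (Tup k n)} {M : ℕ} {c : ℕ → Tup k n}

lemma apply_mod (h : IsEulerianCircuit X M c) (i : ℕ) : c (i % M) = c i :=
  (show Function.Periodic c M from h.closed).map_mod_nat i

lemma mem (h : IsEulerianCircuit X M c) (i : ℕ) : c i ∈ X := by
  rw [← h.apply_mod]
  exact h.bij.mapsTo (Nat.mod_lt i h.pos)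

lemma ncard_eq (h : IsEulerianCircuit X M c) : X.ncard = M := by
  rw [← h.bij.image_eq, h.bij.injOn.ncard_image]
  simp

/-- Along a walk, entry `j + 1` of an edge is entry `j` of the next one, hence ultimately the first
entry of a later edge. -/
lemma window_eq (hn : 0 < n) (h : IsEulerianCircuit X M c) (i : ℕ) :
    window n (fun i => c i ⟨0, hn⟩) i = c i := by
  have key : ∀ (j i : ℕ) (hj : j < n), c (i + j) ⟨0, hn⟩ = c i ⟨j, hj⟩ := by
    intro j
    induction j with
    | zero => exact fun i _ => rfl
    | succ j ih =>
      intro i hj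
      have hw := congrFun (h.walk i) ⟨j, by omega⟩
      simp only [target, source] at hw
      rw [hw, ← ih (i + 1) (by omega), add_right_comm, add_assoc]
  exact funext fun j => key j i j.isLt

theorem isNOS [NeZero k] (hn : 0 < n) (hX : IsX k n X) (h : IsEulerianCircuit X M c) :
    IsNOS k n M (fun i => c i ⟨0, hn⟩) where
  pos := h.pos
  periodic i := by simp only [h.closed]
  inj i j hij := by
    rw [h.window_eq hn, h.window_eq hn, ← h.apply_mod i, ← h.apply_mod j] at hij
    exact h.bij.injOn (Nat.mod_lt i h.pos) (Nat.mod_lt j h.pos) hij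
  neg_orientable i j hij := by
    rw [h.window_eq hn, h.window_eq hn] at hij
    exact hX.negRev_notMem (h.mem j) (hij ▸ h.mem i)

end IsEulerianCircuit

/-! ### The maximum period -/

lemma IsNOS.two_mul_le [NeZero k] {p : ℕ} {s : ℕ → ZMod k} (h : IsNOS k n p s) :
    2 * p ≤ k ^ n := by
  have hinj : Set.InjOn (window n s) (Set.Iio p) := by
    intro i hi j hj hij
    have := h.inj i j hij
    rwa [Nat.ModEq, Nat.mod_eq_of_lt hi, Nat.mod_eq_of_lt hj] at this
  have hW : (window n s '' Set.Iio p).ncard = p := by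
    rw [hinj.ncard_image]
    simp
  have hdisj : Disjoint (window n s '' Set.Iio p) (negRev '' (window n s '' Set.Iio p)) := by
    rw [Set.disjoint_left]
    rintro _ ⟨i, -, rfl⟩ ⟨_, ⟨j, -, rfl⟩, hij⟩
    exact h.neg_orientable i j hij.symm
  calc 2 * p = (window n s '' Set.Iio p ∪ negRev '' (window n s '' Set.Iio p)).ncard := by
        rw [Set.ncard_union_eq hdisj (Set.toFinite _) (Set.toFinite _),
          Set.ncard_image_of_injective _ negRev_injective, hW, two_mul]
    _ ≤ Nat.card (Tup k n) := Set.ncard_le_card _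
    _ = k ^ n := by simp

/-- Nonemptiness and boundedness ensure that the `sSup` is a true maximum and not a default value.
-/
theorem isGreatest_maxPeriod (hn : 0 < n) (hk : 3 ≤ k) :
    IsGreatest (nosPeriods n k) (maxPeriod n k) := by
  have : NeZero k := ⟨by omega⟩
  have hbdd : BddAbove (nosPeriods n k) := by
    refine ⟨k ^ n, ?_⟩
    rintro p ⟨s, hs⟩
    have := hs.two_mul_le
    omega
  have hne : (nosPeriods n k).Nonempty := by
    obtain ⟨X, hX⟩ := exists_isX (k := k) (n := n)
    obtain ⟨M, c, hc⟩ := hX.exists_isEulerianCircuit hn hk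
    exact ⟨M, _, hc.isNOS hn hX⟩
  exact ⟨Nat.sSup_mem hne hbdd, fun p hp => le_csSup hbdd hp⟩

/-! ### Negasymmetric circuits -/

lemma minimalPeriod_rot_dvd_iff (a : Tup k n) (j : ℕ) :
    Function.minimalPeriod (fun b => rot b 1) a ∣ j ↔ rot a j = a := by
  rw [← Function.isPeriodicPt_iff_minimalPeriod_dvd, rot_eq_iterate]
  rfl

lemma minimalPeriod_rot_pos (hn : 0 < n) (a : Tup k n) :
    0 < Function.minimalPeriod (fun b => rot b 1) a := by
  refine Nat.pos_of_dvd_of_pos ((minimalPeriod_rot_dvd_iff a n).2 ?_) hn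
  simpa using rot_mul_self a 1

lemma rot_injOn_minimalPeriod (a : Tup k n) :
    Set.InjOn (rot a) (Set.Iio (Function.minimalPeriod (fun b => rot b 1) a)) := by
  intro i hi j hj hij
  rw [rot_eq_iterate, rot_eq_iterate] at hij
  exact Function.iterate_injOn_Iio_minimalPeriod hi hj hij

lemma rot_mod_minimalPeriod (a : Tup k n) (j : ℕ) :
    rot a (j % Function.minimalPeriod (fun b => rot b 1) a) = rot a j := by
  rw [rot_eq_iterate, rot_eq_iterate, Function.iterate_mod_minimalPeriod_eq]

lemma ncard_circuit (hn : 0 < n) (a : Tup k n) :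
    (circuit a).ncard = Function.minimalPeriod (fun b => rot b 1) a := by
  have h : circuit a = rot a '' Set.Iio (Function.minimalPeriod (fun b => rot b 1) a) := by
    refine Set.Subset.antisymm ?_ (Set.image_subset_range _ _)
    rintro _ ⟨j, rfl⟩
    exact ⟨_, Nat.mod_lt _ (minimalPeriod_rot_pos hn a), rot_mod_minimalPeriod a j⟩
  rw [h, (rot_injOn_minimalPeriod a).ncard_image]
  simp

/-- With `a` negasymmetric, the reverse complement of its shift by `j` is its shift by `-j`. -/
lemma isNegasymmetric_rot_iff {a : Tup k n} (ha : IsNegasymmetric a) (j : ℕ) :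
    IsNegasymmetric (rot a j) ↔ rot a (2 * j) = a := by
  have h : rot (negRev (rot a j)) j = a := (rot_negRev_rot a j).trans ha.symm
  rw [IsNegasymmetric, ← (rot_injective j).eq_iff, rot_rot, h, two_mul]

lemma ncard_setOf_dvd_two_mul {p : ℕ} (hp : 0 < p) :
    {j | j < p ∧ p ∣ 2 * j}.ncard = if Even p then 2 else 1 := by
  split_ifs with h
  · obtain ⟨q, rfl⟩ := h
    have : {j | j < q + q ∧ q + q ∣ 2 * j} = {0, q} := by
      ext j
      simp only [Set.mem_ofPred_eq, Set.mem_insert_iff, Set.mem_singleton_iff]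
      constructor
      · rintro ⟨h1, h2⟩
        rw [← two_mul, Nat.mul_dvd_mul_iff_left two_pos] at h2
        obtain ⟨r, rfl⟩ := h2
        have : r < 2 := by
          by_contra hr
          have : q * 2 ≤ q * r := Nat.mul_le_mul_left q (by omega)
          omega
        interval_cases r <;> simp
      · rintro (rfl | rfl)
        · exact ⟨hp, by simp⟩
        · exact ⟨by omega, by rw [two_mul]⟩
    rw [this, Set.ncard_pair (by omega)]
  · have : {j | j < p ∧ p ∣ 2 * j} = {0} := by
      ext j
      simp only [Set.mem_ofPred_eq, Set.mem_singleton_iff]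
      constructor
      · rintro ⟨h1, h2⟩
        have hc : Nat.Coprime p 2 := (Nat.coprime_two_right).2 (Nat.not_even_iff_odd.1 h)
        exact Nat.eq_zero_of_dvd_of_lt (hc.dvd_of_dvd_mul_left h2) h1
      · rintro rfl
        exact ⟨hp, by simp⟩
    rw [this, Set.ncard_singleton]

lemma ncard_isNegasymmetric (hn : 0 < n) {a : Tup k n} (ha : IsNegasymmetric a) :
    {b ∈ circuit a | IsNegasymmetric b}.ncard = if Even (circuit a).ncard then 2 else 1 := by
  have hp := minimalPeriod_rot_pos hn a
  rw [ncard_circuit hn, ← ncard_setOf_dvd_two_mul hp]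
  have : {b ∈ circuit a | IsNegasymmetric b} = rot a ''
      {j | j < Function.minimalPeriod (fun b => rot b 1) a ∧
        Function.minimalPeriod (fun b => rot b 1) a ∣ 2 * j} := by
    ext b
    constructor
    · rintro ⟨⟨j, rfl⟩, hj⟩
      refine ⟨_, ⟨Nat.mod_lt j hp, ?_⟩, rot_mod_minimalPeriod a j⟩
      rw [minimalPeriod_rot_dvd_iff, ← isNegasymmetric_rot_iff ha, rot_mod_minimalPeriod]
      exact hj
    · rintro ⟨j, ⟨-, hj⟩, rfl⟩
      rw [minimalPeriod_rot_dvd_iff] at hj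
      exact ⟨rot_mem_circuit a j, (isNegasymmetric_rot_iff ha j).2 hj⟩
  rw [this]
  exact ((rot_injOn_minimalPeriod a).mono fun j hj => hj.1).ncard_image

lemma mem_negCircuits_cases [NeZero k] (hn : 0 < n) {C : Set (Tup k n)} (hC : C ∈ circuits k n)
    (hneg : IsNegasymmetricCircuit C) :
    C ∈ negCircuits 0 n k ∨ C ∈ negCircuits 1 n k ∨ C ∈ negCircuits 2 n k := by
  by_cases h : ∃ a ∈ C, IsNegasymmetric a
  · obtain ⟨a, haC, ha⟩ := h
    obtain ⟨rfl, -⟩ := eq_circuit_of_mem hC haC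
    have := ncard_isNegasymmetric hn ha
    split_ifs at this
    · exact Or.inr (Or.inr ⟨hC, hneg, this⟩)
    · exact Or.inr (Or.inl ⟨hC, hneg, this⟩)
  · refine Or.inl ⟨hC, hneg, ?_⟩
    rw [Set.ncard_eq_zero (Set.toFinite _)]
    exact Set.eq_empty_iff_forall_notMem.2 fun a ha => h ⟨a, ha.1, ha.2⟩

lemma oddPart_pos (hn : 0 < n) : 0 < oddPart n :=
  Nat.div_pos (Nat.le_of_dvd hn pow_padicValNat_dvd) (by positivity)

lemma dvd_oddPart {p : ℕ} (hp : Odd p) (hpn : p ∣ n) : p ∣ oddPart n := by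
  have h : 2 ^ padicValNat 2 n * oddPart n = n := Nat.mul_div_cancel' pow_padicValNat_dvd
  rw [← h] at hpn
  exact (Nat.Coprime.pow_right _ (Nat.coprime_two_right.2 hp)).dvd_of_dvd_mul_left hpn

lemma ncard_le_of_mem_negCircuits (hn : 0 < n) {i : ℕ} {C : Set (Tup k n)}
    (hC : C ∈ negCircuits i n k) : C.ncard ≤ n := by
  obtain ⟨⟨a, -, rfl⟩, -⟩ := hC
  exact ncard_circuit_le hn a

/-- A single negasymmetric tuple forces the length to be odd, and the length divides `n`, so it
divides the odd part. -/
lemma ncard_le_oddPart (hn : 0 < n) {C : Set (Tup k n)} (hC : C ∈ negCircuits 1 n k) :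
    C.ncard ≤ oddPart n := by
  obtain ⟨hC, -, h1⟩ := hC
  obtain ⟨a, haC, ha⟩ := Set.nonempty_of_ncard_ne_zero (h1 ▸ one_ne_zero)
  obtain ⟨rfl, -⟩ := eq_circuit_of_mem hC haC
  rw [ncard_isNegasymmetric hn ha] at h1
  refine Nat.le_of_dvd (oddPart_pos hn) (dvd_oddPart ?_ ?_)
  · rw [← Nat.not_even_iff_odd]
    intro h
    simp [h] at h1
  · rw [ncard_circuit hn, minimalPeriod_rot_dvd_iff]
    simpa using rot_mul_self a 1

/-! ### Constant circuits -/

/-- The circuits of the constant negasymmetric tuples. -/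
def constCircuits (k n : ℕ) : Set (Set (Tup k n)) :=
  (fun x : ZMod k => {fun _ => x}) '' {x | -x = x}

lemma ncard_neg_eq_self [NeZero k] : {x : ZMod k | -x = x}.ncard = delta k := by
  have hk : 0 < k := Nat.pos_of_ne_zero (NeZero.ne k)
  unfold delta
  split_ifs with h
  · obtain ⟨q, rfl⟩ := h
    have hq : ((q : ZMod (q + q))).val = q := ZMod.val_cast_of_lt (by omega)
    have : {x : ZMod (q + q) | -x = x} = {0, (q : ZMod (q + q))} := by
      ext x
      simp only [Set.mem_ofPred_eq, Set.mem_insert_iff, Set.mem_singleton_iff, ZMod.neg_eq_self_iff]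
      refine or_congr Iff.rfl ⟨fun h => ZMod.val_injective _ ?_, ?_⟩
      · omega
      · rintro rfl
        omega
    rw [this, Set.ncard_pair]
    intro h0
    rw [← h0, ZMod.val_zero] at hq
    omega
  · have : {x : ZMod k | -x = x} = {0} := by
      ext x
      simp only [Set.mem_ofPred_eq, Set.mem_singleton_iff, ZMod.neg_eq_self_iff]
      refine or_iff_left fun h' => h ⟨x.val, by omega⟩
    rw [this, Set.ncard_singleton]

lemma ncard_constCircuits [NeZero k] (hn : 0 < n) : (constCircuits k n).ncard = delta k := by
  rw [constCircuits, Set.ncard_image_of_injective, ncard_neg_eq_self]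
  intro x y h
  exact congrFun (Set.singleton_injective h) ⟨0, hn⟩

lemma constCircuits_subset [NeZero k] : constCircuits k n ⊆ negCircuits 1 n k := by
  rintro _ ⟨x, hx, rfl⟩
  have hx : -x = x := hx
  have hmid : (fun _ => x) ∈ midEdges k n := by
    have hw := entryWeight_neg x
    rw [hx] at hw
    show pseudoweight (fun _ => x) = (k : ℚ) * n / 2
    simp only [pseudoweight_eq_sum, Finset.sum_const, Finset.card_univ, Fintype.card_fin,
      nsmul_eq_mul]
    linear_combination (n : ℚ) / 2 * hw
  have hneg : IsNegasymmetric (fun _ : Fin n => x) := funext fun _ => hx.symm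
  refine ⟨⟨_, hmid, ?_⟩, ⟨_, rfl, _, rfl, hneg⟩, ?_⟩
  · exact Set.range_eq_singleton_iff.2 fun _ => rfl
  · rw [Set.ncard_eq_one]
    refine ⟨fun _ => x, Set.ext fun b => ⟨fun h => h.1, ?_⟩⟩
    rintro rfl
    exact ⟨rfl, hneg⟩

/-! ### The number of edges of `X` -/

lemma ncard_sUnion_le {α : Type*} [Finite α] (S : Set (Set α)) (B : ℕ)
    (h : ∀ C ∈ S, C.ncard ≤ B) : (⋃₀ S).ncard ≤ S.ncard * B := by
  induction S, S.toFinite using Set.Finite.induction_on with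
  | empty => simp
  | @insert C S hC hS ih =>
    rw [Set.sUnion_insert, Set.ncard_insert_of_notMem hC, add_mul, one_mul, add_comm]
    refine (Set.ncard_union_le _ _).trans (add_le_add (h C (Set.mem_insert _ _)) ?_)
    exact ih fun C' hC' => h C' (Set.mem_insert_of_mem _ hC')

/-- The `δ` constant circuits contribute one tuple each; every other circuit contributes at most
`m`. -/
lemma ncard_sUnion_negCircuits_one [NeZero k] (hn : 0 < n) :
    ((⋃₀ negCircuits 1 n k).ncard : ℝ) ≤
      oddPart n * (((negCircuits 1 n k).ncard : ℝ) - delta k) + delta k := by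
  have hsub : constCircuits k n ⊆ negCircuits 1 n k := constCircuits_subset
  have h1 : (⋃₀ constCircuits k n).ncard ≤ delta k := by
    rw [← ncard_constCircuits hn]
    refine (ncard_sUnion_le _ 1 ?_).trans_eq (mul_one _)
    rintro _ ⟨x, -, rfl⟩
    rw [Set.ncard_singleton]
  have h2 := ncard_sUnion_le (negCircuits 1 n k \ constCircuits k n) (oddPart n)
    fun C hC => ncard_le_oddPart hn hC.1
  have h3 : ((negCircuits 1 n k \ constCircuits k n).ncard : ℝ) =
      (negCircuits 1 n k).ncard - delta k := by
    rw [Set.ncard_sdiff hsub, ncard_constCircuits hn, Nat.cast_sub]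
    rw [← ncard_constCircuits hn]
    exact Set.ncard_le_ncard hsub
  have h4 : (⋃₀ negCircuits 1 n k).ncard ≤
      (negCircuits 1 n k \ constCircuits k n).ncard * oddPart n + delta k := by
    conv_lhs => rw [← Set.sdiff_union_of_subset hsub, Set.sUnion_union]
    exact (Set.ncard_union_le _ _).trans (add_le_add h2 h1)
  have h5 : ((⋃₀ negCircuits 1 n k).ncard : ℝ) ≤
      ((negCircuits 1 n k \ constCircuits k n).ncard : ℝ) * oddPart n + delta k := by
    exact_mod_cast h4
  rw [h3] at h5
  linarith

theorem IsX.sBound_le_ncard [NeZero k] (hn : 0 < n) {X : Set (Tup k n)} (hX : IsX k n X) :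
    sBound k n ≤ X.ncard := by
  have hcover : (Set.univ : Set (Tup k n)) ⊆ (X ∪ negRev '' X) ∪
      (⋃₀ negCircuits 0 n k ∪ ⋃₀ negCircuits 2 n k ∪ ⋃₀ negCircuits 1 n k) := by
    intro a _
    rcases hX.mem_or_negRev_mem_or a with h | h | ⟨hm, hneg⟩
    · exact Or.inl (Or.inl h)
    · exact Or.inl (Or.inr ⟨_, h, negRev_negRev a⟩)
    · rcases mem_negCircuits_cases hn ⟨a, hm, rfl⟩ hneg with h | h | h
      · exact Or.inr (Or.inl (Or.inl ⟨_, h, mem_circuit_self a⟩))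
      · exact Or.inr (Or.inr ⟨_, h, mem_circuit_self a⟩)
      · exact Or.inr (Or.inl (Or.inr ⟨_, h, mem_circuit_self a⟩))
  have hcard : k ^ n ≤ (X.ncard + X.ncard) +
      ((negCircuits 0 n k).ncard * n + (negCircuits 2 n k).ncard * n +
        (⋃₀ negCircuits 1 n k).ncard) := by
    calc k ^ n = (Set.univ : Set (Tup k n)).ncard := by simp [Set.ncard_univ]
      _ ≤ _ := Set.ncard_le_ncard hcover
      _ ≤ _ := (Set.ncard_union_le _ _).trans <| add_le_add
          ((Set.ncard_union_le _ _).trans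
            (add_le_add le_rfl (Set.ncard_image_of_injective _ negRev_injective).le))
          ((Set.ncard_union_le _ _).trans <| add_le_add
            ((Set.ncard_union_le _ _).trans <| add_le_add
              (ncard_sUnion_le _ _ fun C => ncard_le_of_mem_negCircuits hn)
              (ncard_sUnion_le _ _ fun C => ncard_le_of_mem_negCircuits hn)) le_rfl)
  have hcard' : (k : ℝ) ^ n ≤ (X.ncard + X.ncard) +
      ((negCircuits 0 n k).ncard * n + (negCircuits 2 n k).ncard * n +
        (⋃₀ negCircuits 1 n k).ncard) := by
    exact_mod_cast hcard
  have h1 := ncard_sUnion_negCircuits_one (k := k) hn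
  unfold sBound
  linarith

/-! ### Counting negasymmetric circuits -/

/-- The hypothesis pairs positions whose sum is `j - 1` modulo `n`; for positions below `n` the two
displayed alternatives are the only ones. -/
lemma apply_eq_of_negRev_eq_rot {j : ℕ} {a : Tup k n} (h : negRev a = rot a j)
    (x y : ℕ) (hx : x < n) (hy : y < n) (hxy : x + y + 1 = j ∨ x + y + 1 = n + j) :
    a ⟨x, hx⟩ = -a ⟨y, hy⟩ := by
  have hi : n - 1 - y < n := by omega
  have := congrFun h ⟨n - 1 - y, hi⟩
  simp only [negRev, rot] at this
  have e1 : Fin.rev (⟨n - 1 - y, hi⟩ : Fin n) = ⟨y, hy⟩ := by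
    ext
    simp only [Fin.val_rev]
    omega
  have e2 : (n - 1 - y + j) % n = x := by
    rcases hxy with hxy | hxy
    · rw [show n - 1 - y + j = x + n by omega, Nat.add_mod_right, Nat.mod_eq_of_lt hx]
    · rw [show n - 1 - y + j = x by omega, Nat.mod_eq_of_lt hx]
  rw [e1] at this
  simp only [e2] at this
  exact this.symm

/-- The entries that determine a tuple `a` with `negRev a = rot a j`. -/
def freeEntries (j : ℕ) (a : Tup k n) (hn : 0 < n) : Fin ((n + 2) / 2) → ZMod k :=
  fun i => if (i : ℕ) < (j + 1) / 2 then a ⟨i % n, Nat.mod_lt _ hn⟩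
    else a ⟨(j + (i - (j + 1) / 2)) % n, Nat.mod_lt _ hn⟩

/-- The pairing reverses each of the blocks `[0, j)` and `[j, n)`, so the first half of each,
rounded up, determines the tuple: at most `(n + 2) / 2` entries, attained when both blocks are odd.
-/
lemma ncard_negRev_eq_rot_le [NeZero k] (hn : 0 < n) {j : ℕ} (hj : j < n) :
    {a : Tup k n | negRev a = rot a j}.ncard ≤ k ^ ((n + 2) / 2) := by
  have hinj : Set.InjOn (fun a : Tup k n => freeEntries j a hn) {a | negRev a = rot a j} := by
    intro a ha b hb hab
    have ha : negRev a = rot a j := ha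
    have hb : negRev b = rot b j := hb
    have hlow : ∀ x (hx : x < n), x < (j + 1) / 2 → a ⟨x, hx⟩ = b ⟨x, hx⟩ := by
      intro x hx hxj
      have := congrFun hab ⟨x, by omega⟩
      simpa only [freeEntries, hxj, if_true, Nat.mod_eq_of_lt hx] using this
    have hhigh : ∀ x (hx : x < n), j ≤ x → x - j < (n - j + 1) / 2 →
        a ⟨x, hx⟩ = b ⟨x, hx⟩ := by
      intro x hx hjx hxj
      have := congrFun hab ⟨x - j + (j + 1) / 2, by omega⟩
      have h1 : ¬ (x - j + (j + 1) / 2 < (j + 1) / 2) := by omega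
      have h2 : (j + (x - j + (j + 1) / 2 - (j + 1) / 2)) % n = x := by
        rw [Nat.add_sub_cancel, Nat.add_sub_cancel' hjx, Nat.mod_eq_of_lt hx]
      simpa only [freeEntries, h1, if_false, h2] using this
    funext ⟨x, hx⟩
    by_cases h1 : x < j
    · by_cases h2 : x < (j + 1) / 2
      · exact hlow x hx h2
      · have hy : j - 1 - x < n := by omega
        rw [apply_eq_of_negRev_eq_rot ha x (j - 1 - x) hx hy (by omega),
          apply_eq_of_negRev_eq_rot hb x (j - 1 - x) hx hy (by omega),
          hlow _ hy (by omega)]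
    · by_cases h2 : x - j < (n - j + 1) / 2
      · exact hhigh x hx (by omega) h2
      · have hy : n + j - 1 - x < n := by omega
        rw [apply_eq_of_negRev_eq_rot ha x (n + j - 1 - x) hx hy (by omega),
          apply_eq_of_negRev_eq_rot hb x (n + j - 1 - x) hx hy (by omega),
          hhigh _ hy (by omega) (by omega)]
  rw [← hinj.ncard_image]
  refine (Set.ncard_le_card _).trans_eq ?_
  simp

lemma ncard_negCircuits_le [NeZero k] (hn : 0 < n) (i : ℕ) :
    (negCircuits i n k).ncard ≤ n * k ^ ((n + 2) / 2) := by
  have hsub : negCircuits i n k ⊆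
      circuit '' ⋃ j ∈ Finset.range n, {a : Tup k n | negRev a = rot a j} := by
    rintro _ ⟨⟨a, -, rfl⟩, hneg, -⟩
    have h : negRev a ∈ circuit a := by
      rw [← (isNegasymmetricCircuit_circuit_iff a).1 hneg]
      exact mem_circuit_self _
    obtain ⟨j, hj⟩ := h
    refine ⟨a, Set.mem_biUnion (Finset.mem_range.2 (Nat.mod_lt j hn)) ?_, rfl⟩
    show negRev a = rot a (j % n)
    rw [← hj]
    conv_lhs => rw [← Nat.div_add_mod j n, ← rot_rot, rot_mul_self]
  calc (negCircuits i n k).ncard ≤ _ := Set.ncard_le_ncard hsub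
    _ ≤ _ := Set.ncard_image_le (Set.toFinite _)
    _ ≤ ∑ j ∈ Finset.range n, {a : Tup k n | negRev a = rot a j}.ncard :=
        Finset.set_ncard_biUnion_le _ _
    _ ≤ ∑ j ∈ Finset.range n, k ^ ((n + 2) / 2) :=
        Finset.sum_le_sum fun j hj => ncard_negRev_eq_rot_le hn (Finset.mem_range.1 hj)
    _ = n * k ^ ((n + 2) / 2) := by simp

/-! ### Asymptotic optimality -/

lemma one_sub_mul_le_sBound [NeZero k] (hn : 0 < n) :
    (1 - 3 * (n : ℝ) ^ 2 / (k : ℝ) ^ ((n - 1) / 2)) * ((k : ℝ) ^ n / 2) ≤ sBound k n := by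
  have hk : (0 : ℝ) < k := by exact_mod_cast Nat.pos_of_ne_zero (NeZero.ne k)
  have hN : ∀ i, ((negCircuits i n k).ncard : ℝ) ≤ n * (k : ℝ) ^ ((n + 2) / 2) := fun i => by
    exact_mod_cast ncard_negCircuits_le hn i
  -- The two rounded-down exponents add up to exactly `n` for either parity.
  have hsplit : (k : ℝ) ^ n = (k : ℝ) ^ ((n + 2) / 2) * (k : ℝ) ^ ((n - 1) / 2) := by
    rw [← pow_add]
    congr 1
    omega
  have hm : (1 : ℝ) ≤ oddPart n := by exact_mod_cast oddPart_pos hn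
  have hm' : (oddPart n : ℝ) ≤ n := by exact_mod_cast Nat.div_le_self _ _
  have hd : (0 : ℝ) ≤ delta k := Nat.cast_nonneg _
  have hn0 : (0 : ℝ) ≤ n := Nat.cast_nonneg _
  have e : (1 - 3 * (n : ℝ) ^ 2 / (k : ℝ) ^ ((n - 1) / 2)) * ((k : ℝ) ^ n / 2) =
      ((k : ℝ) ^ n - 3 * n * (n * (k : ℝ) ^ ((n + 2) / 2))) / 2 := by
    rw [hsplit]
    field_simp
  rw [e, sBound]
  have h0 := mul_le_mul_of_nonneg_left (hN 0) hn0
  have h2 := mul_le_mul_of_nonneg_left (hN 2) hn0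
  have h1 := mul_le_mul_of_nonneg_left (hN 1) hn0
  have h1' := mul_le_mul_of_nonneg_right hm'
    (Nat.cast_nonneg (α := ℝ) (negCircuits 1 n k).ncard)
  -- The `δ` terms contribute `(m - 1) δ ≥ 0` and can be dropped.
  have hd' := mul_le_mul_of_nonneg_right hm hd
  linarith

lemma sBound_le_maxPeriod (hn : 0 < n) (hk : 3 ≤ k) : sBound k n ≤ maxPeriod n k := by
  have : NeZero k := ⟨by omega⟩
  obtain ⟨X, hX⟩ := exists_isX (k := k) (n := n)
  obtain ⟨M, c, hc⟩ := hX.exists_isEulerianCircuit hn hk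
  refine (hX.sBound_le_ncard hn).trans ?_
  rw [hc.ncard_eq]
  exact_mod_cast (isGreatest_maxPeriod hn hk).2 ⟨_, hc.isNOS hn hX⟩

lemma maxPeriod_pos (hn : 0 < n) (hk : 3 ≤ k) : 0 < maxPeriod n k := by
  obtain ⟨s, hs⟩ := (isGreatest_maxPeriod hn hk).1
  exact hs.pos

lemma sBound_div_maxPeriod_le_one (hn : 0 < n) (hk : 3 ≤ k) :
    sBound k n / maxPeriod n k ≤ 1 :=
  div_le_one_of_le₀ (sBound_le_maxPeriod hn hk) (Nat.cast_nonneg _)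

lemma one_sub_le_sBound_div_maxPeriod (hn : 0 < n) (hk : 3 ≤ k)
    (h : 3 * (n : ℝ) ^ 2 / (k : ℝ) ^ ((n - 1) / 2) ≤ 1) :
    1 - 3 * (n : ℝ) ^ 2 / (k : ℝ) ^ ((n - 1) / 2) ≤ sBound k n / maxPeriod n k := by
  have : NeZero k := ⟨by omega⟩
  have hpos : (0 : ℝ) < maxPeriod n k := by exact_mod_cast maxPeriod_pos hn hk
  obtain ⟨s, hs⟩ := (isGreatest_maxPeriod hn hk).1
  have h2 : 2 * (maxPeriod n k : ℝ) ≤ (k : ℝ) ^ n := by exact_mod_cast hs.two_mul_le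
  rw [le_div_iff₀ hpos]
  refine le_trans ?_ (one_sub_mul_le_sBound hn)
  exact mul_le_mul_of_nonneg_left (by linarith) (by linarith)

/-- If the relative error tends to zero along a family of parameters, then `s / ℓ` tends to
one. -/
lemma tendsto_sBound_div_maxPeriod {ι : Type*} {l : Filter ι} (n k : ι → ℕ)
    (hn : ∀ᶠ i in l, 0 < n i) (hk : ∀ᶠ i in l, 3 ≤ k i)
    (h : Tendsto (fun i => 3 * (n i : ℝ) ^ 2 / (k i : ℝ) ^ ((n i - 1) / 2)) l (𝓝 0)) :
    Tendsto (fun i => sBound (k i) (n i) / (maxPeriod (n i) (k i) : ℝ)) l (𝓝 1) := by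
  refine tendsto_of_tendsto_of_tendsto_of_le_of_le' (g := fun i =>
    1 - 3 * (n i : ℝ) ^ 2 / (k i : ℝ) ^ ((n i - 1) / 2)) (by simpa using h.const_sub 1)
    tendsto_const_nhds ?_ ?_
  · filter_upwards [hn, hk, h.eventually_le_const one_pos] with i h1 h2 h3
    exact one_sub_le_sBound_div_maxPeriod h1 h2 h3
  · filter_upwards [hn, hk] with i h1 h2
    exact sBound_div_maxPeriod_le_one h1 h2

lemma tendsto_sq_div_pow_length (hk : 3 ≤ k) :
    Tendsto (fun n : ℕ => 3 * (n : ℝ) ^ 2 / (k : ℝ) ^ ((n - 1) / 2)) atTop (𝓝 0) := by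
  have hk' : (3 : ℝ) ≤ k := by exact_mod_cast hk
  have hk0 : (0 : ℝ) < k := by linarith
  have hr : |(k : ℝ)⁻¹| < 1 := by
    rw [abs_of_pos (by positivity)]
    exact inv_lt_one_of_one_lt₀ (by linarith)
  have hhalf : Tendsto (fun n : ℕ => (n + 1) / 2) atTop atTop :=
    tendsto_atTop_atTop.2 fun b => ⟨2 * b, fun a ha => by omega⟩
  -- With `j = (n + 1) / 2`, so that `n ≤ 2j`, the error is at most `12 k j² k⁻ʲ`.
  have hu := ((tendsto_pow_const_mul_const_pow_of_abs_lt_one 2 hr).comp hhalf).const_mul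
    (12 * (k : ℝ))
  rw [mul_zero] at hu
  refine squeeze_zero' (Eventually.of_forall fun n => by positivity) ?_ hu
  filter_upwards [eventually_ge_atTop 1] with n hn
  have hn2 : (n : ℝ) ≤ 2 * ((n + 1) / 2 : ℕ) := by
    exact_mod_cast (by omega : n ≤ 2 * ((n + 1) / 2))
  -- Truncated subtraction makes this false at `n = 0`.
  have hexp : (n + 1) / 2 = (n - 1) / 2 + 1 := by omega
  have hsq : (n : ℝ) ^ 2 ≤ (2 * ((n + 1) / 2 : ℕ)) ^ 2 :=
    pow_le_pow_left₀ (Nat.cast_nonneg _) hn2 2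
  have hpow : (k : ℝ) * ((k : ℝ)⁻¹) ^ ((n + 1) / 2) = ((k : ℝ) ^ ((n - 1) / 2))⁻¹ := by
    rw [hexp, pow_succ', ← mul_assoc, mul_inv_cancel₀ hk0.ne', one_mul, inv_pow]
  calc 3 * (n : ℝ) ^ 2 / (k : ℝ) ^ ((n - 1) / 2)
      ≤ 3 * (2 * ((n + 1) / 2 : ℕ)) ^ 2 / (k : ℝ) ^ ((n - 1) / 2) := by gcongr
    _ = 12 * ((n + 1) / 2 : ℕ) ^ 2 * ((k : ℝ) * ((k : ℝ)⁻¹) ^ ((n + 1) / 2)) := by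
      rw [hpow]
      ring
    _ = _ := by
      simp only [Function.comp]
      ring

/-- For `n ≥ 3` the exponent is at least one, so the denominator grows with `k`. -/
lemma tendsto_sq_div_pow_alphabet (hn : 3 ≤ n) :
    Tendsto (fun k : ℕ => 3 * (n : ℝ) ^ 2 / (k : ℝ) ^ ((n - 1) / 2)) atTop (𝓝 0) :=
  Tendsto.const_div_atTop
    ((tendsto_pow_atTop (by omega)).comp tendsto_natCast_atTop_atTop) _

end NegOrientable

theorem mainTheorem4 :
    (∀ (n k : ℕ) (hn : 3 ≤ n) (_hk : 3 ≤ k),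
      (∃ X : Set (NegOrientable.Tup k n), NegOrientable.IsX k n X) ∧
      ∀ X : Set (NegOrientable.Tup k n), NegOrientable.IsX k n X →
        (∃ (M : ℕ) (c : ℕ → NegOrientable.Tup k n), NegOrientable.IsEulerianCircuit X M c) ∧
        ∀ (M : ℕ) (c : ℕ → NegOrientable.Tup k n), NegOrientable.IsEulerianCircuit X M c →
          NegOrientable.IsNOS k n M (fun i => c i ⟨0, by omega⟩) ∧
          NegOrientable.sBound k n ≤ (M : ℝ)) ∧
    (∀ n k : ℕ, 3 ≤ n → 3 ≤ k →
      IsGreatest (NegOrientable.nosPeriods n k) (NegOrientable.maxPeriod n k)) ∧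
    (∀ k : ℕ, 3 ≤ k →
      Tendsto (fun n : ℕ => NegOrientable.sBound k n / (NegOrientable.maxPeriod n k : ℝ))
        atTop (𝓝 1)) ∧
    (∀ n : ℕ, 3 ≤ n →
      Tendsto (fun k : ℕ => NegOrientable.sBound k n / (NegOrientable.maxPeriod n k : ℝ))
        atTop (𝓝 1)) := by
  refine ⟨fun n k hn hk => ?_, fun n k hn hk => ?_, fun k hk => ?_, fun n hn => ?_⟩
  · have : NeZero k := ⟨by omega⟩
    refine ⟨NegOrientable.exists_isX, fun X hX => ?_⟩
    refine ⟨hX.exists_isEulerianCircuit (by omega) hk, fun M c hc => ?_⟩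
    refine ⟨hc.isNOS (by omega) hX, ?_⟩
    rw [← hc.ncard_eq]
    exact hX.sBound_le_ncard (by omega)
  · exact NegOrientable.isGreatest_maxPeriod (by omega) hk
  · exact NegOrientable.tendsto_sBound_div_maxPeriod (fun n => n) (fun _ => k)
      (eventually_gt_atTop 0) (Eventually.of_forall fun _ => hk)
      (NegOrientable.tendsto_sq_div_pow_length hk)
  · exact NegOrientable.tendsto_sBound_div_maxPeriod (fun _ => n) (fun k => k)
      (Eventually.of_forall fun _ => by omega) (eventually_ge_atTop 3)
      (NegOrientable.tendsto_sq_div_pow_alphabet hn)
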